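/- **(Area formula, Lipschitz case)** Let $1 \le k \le n$, let $\Phi : \mathbb{R}^k \to \mathbb{R}^n$ be Lipschitz, and let $E \subset \mathbb{R}^k$ be Lebesgue measurable. For $s \ge 0$ let $\mathcal{H}^s$ be the $s$-dimensional Hausdorff outer measure of a Euclidean space, normalised by $$\mathcal{H}^s(A) = \lim_{\delta \downarrow 0} \frac{\omega_s}{2^s} \inf\Big\{ \sum_{j=1}^\infty (\operatorname{diam} A_j)^s : A \subset \bigcup_{j} A_j,\ \operatorname{diam} A_j \le \delta \Big\}, \qquad \omega_s = \frac{\pi^{s/2}}{\Gamma(1+s/2)},$$ where empty sets $A_j$ contribute $0$ and, for $s=0$, nonempty sets contribute $1$ (so $\mathcal{H}^0$ is counting measure). A set or function is called $\mathcal{H}^k$-measurable if it is measurable with respect to the $\sigma$-algebra of Carathéodory measurable sets of $\mathcal{H}^k$, and integrals $d\mathcal{H}^k$ are taken with respect to the restriction of $\mathcal{H}^k$ to this $\sigma$-algebra. Then: 1. $\Phi(E)$ is $\mathcal{H}^k$-measurable; 2. $\Phi$ is differentiable at $\mathcal{L}^k$-almost every $x$, so that $J(\Phi)(x) = \sqrt{\det\big(d\Phi(x)^*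 \, d\Phi(x)\big)}$ is defined $\mathcal{L}^k$-almost everywhere; 3. the function $y \mapsto \mathcal{H}^0(E \cap \Phi^{-1}(y))$ is $\mathcal{H}^k$-measurable on $\mathbb{R}^n$, and, as an equality in $[0,+\infty]$, $$\int_{\mathbb{R}^n} \mathcal{H}^0\big(E \cap \Phi^{-1}(y)\big)\, d\mathcal{H}^k(y) = \int_E J(\Phi)\, d\mathcal{L}^k .$$ -/

import Mathlib

open MeasureTheory
open scoped NNReal ENNReal

namespace AreaFormula

/-- The constant `ω_s = π^(s/2) / Γ(1 + s/2)`; for a natural number `s` it is the Lebesgue measure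
of the unit ball of `ℝˢ`. -/
noncomputable def omega (s : ℝ) : ℝ :=
  Real.pi ^ (s / 2) / Real.Gamma (1 + s / 2)

/-- The `s`-dimensional Hausdorff outer measure on Euclidean `ℝⁿ`, normalised by `ω_s / 2^s`.
It is defined on all subsets. Mathlib's `μH[s]` is built from `(diam E_k)^s` without the
normalising factor, and its value on an arbitrary set is the value of the outer measure. -/
noncomputable def hausdorffOuter (n : ℕ) (s : ℝ) : OuterMeasure (EuclideanSpace ℝ (Fin n)) :=
  ENNReal.ofReal (omega s / 2 ^ s) •
    (Measure.hausdorffMeasure s : Measure (EuclideanSpace ℝ (Fin n))).toOuterMeasure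

/-- The `s`-dimensional Hausdorff measure: the restriction of the Hausdorff outer measure to the
σ-algebra of its Carathéodory measurable sets. -/
noncomputable def hausdorff (n : ℕ) (s : ℝ) :
    @Measure (EuclideanSpace ℝ (Fin n)) (hausdorffOuter n s).caratheodory :=
  @OuterMeasure.toMeasure _ (hausdorffOuter n s).caratheodory (hausdorffOuter n s) le_rfl

/-- `J(T) = √(det (T* T))` for a linear map `T : ℝᵏ → ℝⁿ`. -/
noncomputable def jacobianLinear {k n : ℕ}
    (T : EuclideanSpace ℝ (Fin k) →L[ℝ] EuclideanSpace ℝ (Fin n)) : ℝ :=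
  √((ContinuousLinearMap.adjoint T ∘L T).det)

/-- `J(Φ)(x) = J(dΦ(x))`, which is meaningful at the points where `Φ` is differentiable. -/
noncomputable def jacobian {k n : ℕ}
    (Φ : EuclideanSpace ℝ (Fin k) → EuclideanSpace ℝ (Fin n)) (x : EuclideanSpace ℝ (Fin k)) : ℝ :=
  jacobianLinear (fderiv ℝ Φ x)

end AreaFormula

namespace AreaFormula

/-! On a piece where `Φ` is uniformly close to a linear map `A`, the distances `‖Φ x - Φ y‖` compare
with `‖S (x - y)‖` for a square map `S` with `S* S` equal to `A* A`, or to `A* A + η²`. A Lipschitz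
comparison costs only the power `k` of its constant, so the image of the piece has measure about
`|det S| ≈ J(A)` times its volume (`exists_forall_hausdorffBorel_image_le`,
`exists_forall_le_hausdorffBorel_image`). Summing over a countable partition and letting the error
tend to zero bounds the measure of any image from above, with equality where the map is injective
and `J ≠ 0`. Where `J ≠ 0` the pieces can be taken injective, so the multiplicity is a countable sum
of indicators of images. By Rademacher's theorem what remains of `E` is a null set and a set where
`J = 0`; both have null image. The comparison needs normalised `ℋᵏ` to be Lebesgue measure on `ℝᵏ`
(`smul_hausdorffMeasure_eq_volume`). One inequality is the isodiametric inequality, derived from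
Prékopa–Leindler; the other fills a ball with small disjoint balls. -/

/-! ### The Prékopa–Leindler inequality. -/

/-- The Prékopa–Leindler property with constant `C`: if `f x * g y ≤ h (x + y) ^ 2` then
`C * ∫ f * ∫ g ≤ (∫ h) ^ 2`. -/
def PrekopaLeindler {V : Type*} [Add V] [MeasurableSpace V] (μ : Measure V) (C : ℝ≥0∞) : Prop :=
  ∀ f g h : V → ℝ≥0∞, Measurable f → Measurable g → Measurable h →
    (∀ x y, f x * g y ≤ h (x + y) ^ 2) →
      C * ((∫⁻ x, f x ∂μ) * ∫⁻ x, g x ∂μ) ≤ (∫⁻ x, h x ∂μ) ^ 2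

/-- The translates `min L + K` and `max K + L` both lie in `S` and meet at most in the point `max K
+ min L`. -/
theorem volume_add_volume_le_of_isCompact {K L S : Set ℝ} (hK : IsCompact K) (hL : IsCompact L)
    (hK0 : K.Nonempty) (hL0 : L.Nonempty) (hS : ∀ x ∈ K, ∀ y ∈ L, x + y ∈ S) :
    volume K + volume L ≤ volume S := by
  have hM := hK.sSup_mem hK0
  have hm := hL.sInf_mem hL0
  set M := sSup K
  set m := sInf L
  have h1 : volume ((fun x => m + x) '' K) = volume K := by simp
  have h2 : volume ((fun x => M + x) '' L) = volume L := by simp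
  have hd : AEDisjoint volume ((fun x => m + x) '' K) ((fun x => M + x) '' L) := by
    refine measure_mono_null (t := {M + m}) ?_ (by simp)
    rintro z ⟨⟨x, hx, rfl⟩, ⟨y, hy, hxy⟩⟩
    have hxM : x ≤ M := le_csSup hK.bddAbove hx
    have hym : m ≤ y := csInf_le hL.bddBelow hy
    simp only [Set.mem_singleton_iff] at hxy ⊢
    linarith
  rw [← h1, ← h2, ← measure_union₀
    ((hL.image (by fun_prop)).measurableSet.nullMeasurableSet) hd]
  apply measure_mono
  rintro z (⟨x, hx, rfl⟩ | ⟨y, hy, rfl⟩)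
  · simpa [add_comm] using hS x hx m hm
  · exact hS M hM y hy

theorem volume_add_volume_le {A B S : Set ℝ} (hA : MeasurableSet A) (hB : MeasurableSet B)
    (hA0 : A.Nonempty) (hB0 : B.Nonempty) (hS : ∀ x ∈ A, ∀ y ∈ B, x + y ∈ S) :
    volume A + volume B ≤ volume S := by
  obtain ⟨a, ha⟩ := hA0
  obtain ⟨b, hb⟩ := hB0
  rw [hA.measure_eq_iSup_isCompact, hB.measure_eq_iSup_isCompact]
  simp only [iSup_and']
  refine ENNReal.biSup_add_biSup_le' (p := fun K => K ⊆ A ∧ IsCompact K)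
    (q := fun K => K ⊆ B ∧ IsCompact K)
    ⟨∅, by simp⟩ ⟨∅, by simp⟩ ?_
  rintro K ⟨hKA, hK⟩ L ⟨hLB, hL⟩
  -- The approximating compact sets may be empty; adjoining `a` and `b` makes them nonempty.
  refine le_trans (add_le_add (measure_mono (Set.subset_insert a K))
    (measure_mono (Set.subset_insert b L))) ?_
  refine volume_add_volume_le_of_isCompact (hK.insert a) (hL.insert b) (by simp) (by simp) ?_
  intro x hx y hy
  exact hS x (Set.insert_subset ha hKA hx) y (Set.insert_subset hb hLB hy)

/-- Layer cake: the superlevel sets of `f` and `g` at height `t` add into that of `h`. Both suprema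
being `1`, these sets are nonempty for `t < 1` and empty for `t ≥ 1`, so one-dimensional
Brunn–Minkowski applies at every height that counts. -/
theorem lintegral_add_lintegral_le_of_sup_eq_one {f g h : ℝ → ℝ} (hf : Measurable f)
    (hg : Measurable g) (hh : Measurable h) (hf0 : ∀ x, 0 ≤ f x) (hg0 : ∀ x, 0 ≤ g x)
    (hh0 : ∀ x, 0 ≤ h x) (hf1 : ∀ x, f x ≤ 1) (hg1 : ∀ x, g x ≤ 1)
    (hfs : ∀ t < 1, ∃ x, t < f x) (hgs : ∀ t < 1, ∃ x, t < g x)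
    (H : ∀ x y, f x * g y ≤ h (x + y) ^ 2) :
    (∫⁻ x, ENNReal.ofReal (f x)) + ∫⁻ x, ENNReal.ofReal (g x) ≤ ∫⁻ x, ENNReal.ofReal (h x) := by
  rw [lintegral_eq_lintegral_meas_lt _ (.of_forall hf0) hf.aemeasurable,
    lintegral_eq_lintegral_meas_lt _ (.of_forall hg0) hg.aemeasurable,
    lintegral_eq_lintegral_meas_lt _ (.of_forall hh0) hh.aemeasurable]
  rw [← lintegral_add_left]
  swap
  · exact Antitone.measurable fun s t hst => measure_mono fun x hx => lt_of_le_of_lt hst hx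
  refine setLIntegral_mono' measurableSet_Ioi fun t ht => ?_
  rcases lt_or_ge t 1 with h1 | h1
  · refine volume_add_volume_le (measurableSet_lt measurable_const hf)
      (measurableSet_lt measurable_const hg) (hfs t h1) (hgs t h1) ?_
    intro x hx y hy
    simp only [Set.mem_ofPred_eq, Set.mem_Ioi] at *
    refine lt_of_pow_lt_pow_left₀ 2 (hh0 _) (lt_of_lt_of_le ?_ (H x y))
    nlinarith
  · have e1 : {a | t < f a} = ∅ := by
      ext x; simpa using (hf1 x).trans h1
    have e2 : {a | t < g a} = ∅ := by
      ext x; simpa using (hg1 x).trans h1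
    simp [e1, e2]

theorem four_mul_le_add_sq (x y : ℝ≥0∞) : 4 * (x * y) ≤ (x + y) ^ 2 := by
  wlog hxy : x ≤ y generalizing x y
  · rw [mul_comm x, add_comm]
    exact this y x (le_of_not_ge hxy)
  obtain ⟨d, rfl⟩ := exists_add_of_le hxy
  calc 4 * (x * (x + d)) ≤ 4 * (x * (x + d)) + d ^ 2 := le_self_add
    _ = _ := by ring

/-- Dividing `f` and `g` by their suprema `a`, `b` and scaling `h` by `(ab)^(-1/2)` reduces to
supremum one; the additive bound then becomes multiplicative through `4xy ≤ (x + y)²`. -/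
theorem prekopaLeindler_real_of_bounded {f g h : ℝ → ℝ≥0∞} (hf : Measurable f)
    (hg : Measurable g) (hh : Measurable h) (hfb : ⨆ x, f x ≠ ∞) (hgb : ⨆ x, g x ≠ ∞)
    (H : ∀ x y, f x * g y ≤ h (x + y) ^ 2) :
    4 * ((∫⁻ x, f x) * ∫⁻ x, g x) ≤ (∫⁻ x, h x) ^ 2 := by
  set a := ⨆ x, f x with ha
  set b := ⨆ x, g x with hb
  have hfa : ∀ x, f x ≤ a := fun x => le_iSup f x
  have hgb' : ∀ x, g x ≤ b := fun x => le_iSup g x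
  rcases eq_or_ne a 0 with ha0 | ha0
  · have : ∀ x, f x = 0 := fun x => by simpa [ha0] using hfa x
    simp [this]
  rcases eq_or_ne b 0 with hb0 | hb0
  · have : ∀ x, g x = 0 := fun x => by simpa [hb0] using hgb' x
    simp [this]
  set c : ℝ≥0∞ := (a⁻¹ * b⁻¹) ^ (1 / 2 : ℝ) with hc
  have hc2 : c ^ 2 = a⁻¹ * b⁻¹ := by
    rw [hc, ← ENNReal.rpow_natCast, ← ENNReal.rpow_mul]; norm_num
  have key : ∀ (u : ℝ → ℝ≥0∞) (s : ℝ≥0∞), s ≠ 0 → s ≠ ∞ → s = ⨆ x, u x →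
      (∀ x, (s⁻¹ * u x) ≤ 1) ∧ ∀ t < 1, ∃ x, t < (s⁻¹ * u x).toReal := by
    intro u s hs hs' hsu
    have h1 : ∀ x, s⁻¹ * u x ≤ 1 := fun x => by
      rw [← ENNReal.inv_mul_cancel hs hs']
      gcongr
      exact hsu ▸ le_iSup u x
    refine ⟨h1, fun t ht => ?_⟩
    have : ENNReal.ofReal t < ⨆ x, s⁻¹ * u x := by
      rw [← ENNReal.mul_iSup, ← hsu, ENNReal.inv_mul_cancel hs hs']
      simpa using ht
    obtain ⟨x, hx⟩ := lt_iSup_iff.1 this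
    refine ⟨x, ?_⟩
    by_contra! h
    refine absurd (ENNReal.ofReal_le_ofReal h) (not_le.2 ?_)
    rwa [ENNReal.ofReal_toReal (ne_top_of_le_ne_top ENNReal.one_ne_top (h1 x))]
  obtain ⟨f1, f2⟩ := key f a ha0 hfb ha
  obtain ⟨g1, g2⟩ := key g b hb0 hgb hb
  -- Capping `c * h` at `1` makes it real-valued and is harmless, since the normalised `f` and `g`
  -- are at most `1`.
  have L := lintegral_add_lintegral_le_of_sup_eq_one (f := fun x => (a⁻¹ * f x).toReal)
    (g := fun x => (b⁻¹ * g x).toReal) (h := fun x => (min (c * h x) 1).toReal)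
    (by fun_prop) (by fun_prop) (by fun_prop)
    (fun x => by positivity) (fun x => by positivity) (fun x => by positivity)
    (fun x => by simpa using ENNReal.toReal_mono (by simp) (f1 x))
    (fun x => by simpa using ENNReal.toReal_mono (by simp) (g1 x)) f2 g2 (by
      intro x y
      rw [← ENNReal.toReal_mul, ← ENNReal.toReal_pow]
      refine ENNReal.toReal_mono (ENNReal.pow_ne_top (ne_top_of_le_ne_top ENNReal.one_ne_top
        (min_le_right _ _))) ?_
      rcases le_total (c * h (x + y)) 1 with h1 | h1
      · rw [min_eq_left h1, mul_pow, hc2, mul_mul_mul_comm]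
        gcongr
        exact H x y
      · rw [min_eq_right h1, one_pow]
        exact mul_le_one' (f1 x) (g1 y))
  have e1 : ∀ x, ENNReal.ofReal (a⁻¹ * f x).toReal = a⁻¹ * f x := fun x =>
    ENNReal.ofReal_toReal (ne_top_of_le_ne_top (by simp) (f1 x))
  have e2 : ∀ x, ENNReal.ofReal (b⁻¹ * g x).toReal = b⁻¹ * g x := fun x =>
    ENNReal.ofReal_toReal (ne_top_of_le_ne_top (by simp) (g1 x))
  have e3 : ∀ x, ENNReal.ofReal (min (c * h x) 1).toReal ≤ c * h x := fun x => by
    rw [ENNReal.ofReal_toReal (ne_top_of_le_ne_top ENNReal.one_ne_top (min_le_right _ _))]; exact min_le_left _ _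
  simp only [e1, e2] at L
  have L' := L.trans (lintegral_mono e3)
  rw [lintegral_const_mul _ hf, lintegral_const_mul _ hg, lintegral_const_mul _ hh] at L'
  have L2 := (four_mul_le_add_sq _ _).trans (pow_le_pow_left' L' 2)
  rw [mul_pow, hc2] at L2
  have := mul_le_mul_right L2 (a * b)
  have hcan : a * b * (a⁻¹ * b⁻¹) = 1 := by
    rw [mul_mul_mul_comm, ENNReal.mul_inv_cancel ha0 hfb, ENNReal.mul_inv_cancel hb0 hgb, one_mul]
  calc _ = (a * b * (a⁻¹ * b⁻¹)) * (4 * ((∫⁻ x, f x) * ∫⁻ x, g x)) := by rw [hcan, one_mul]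
    _ = a * b * (4 * (a⁻¹ * (∫⁻ x, f x) * (b⁻¹ * ∫⁻ x, g x))) := by ring
    _ ≤ _ := this
    _ = (a * b * (a⁻¹ * b⁻¹)) * (∫⁻ x, h x) ^ 2 := by ring
    _ = _ := by rw [hcan, one_mul]

theorem prekopaLeindler_real : PrekopaLeindler (volume : Measure ℝ) 4 := by
  intro f g h hf hg hh H
  have key : ∀ u : ℝ → ℝ≥0∞, Measurable u →
      Filter.Tendsto (fun N : ℕ => ∫⁻ x, min (u x) N) Filter.atTop (nhds (∫⁻ x, u x)) := by
    intro u hu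
    refine lintegral_tendsto_of_tendsto_of_monotone (fun n => by fun_prop) ?_ ?_
    · refine .of_forall fun x n m hnm => ?_
      dsimp only
      gcongr
    · refine .of_forall fun x => ?_
      have := (tendsto_const_nhds (x := u x)).min ENNReal.tendsto_nat_nhds_top
      simpa using this
  have hbd : ∀ N : ℕ, 4 * ((∫⁻ x, min (f x) N) * ∫⁻ x, min (g x) N) ≤ (∫⁻ x, h x) ^ 2 := by
    intro N
    refine prekopaLeindler_real_of_bounded (by fun_prop) (by fun_prop) hh ?_ ?_ ?_
    · exact ne_top_of_le_ne_top (ENNReal.natCast_ne_top N) (iSup_le fun x => min_le_right _ _)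
    · exact ne_top_of_le_ne_top (ENNReal.natCast_ne_top N) (iSup_le fun x => min_le_right _ _)
    · exact fun x y => (mul_le_mul' (min_le_left _ _) (min_le_left _ _)).trans (H x y)
  -- Multiplication on `ℝ≥0∞` is discontinuous at `0 * ∞`, so vanishing integrals are removed before
  -- the limit in the truncation level.
  rcases eq_or_ne (∫⁻ x, f x) 0 with f0 | f0
  · simp [f0]
  rcases eq_or_ne (∫⁻ x, g x) 0 with g0 | g0
  · simp [g0]
  refine le_of_tendsto' (ENNReal.Tendsto.const_mul
    (ENNReal.Tendsto.mul (key f hf) (.inl f0) (key g hg) (.inl g0)) (.inr (by simp))) hbd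

/-- Tonelli: the property of `ν` on fibres is exactly the hypothesis needed by `μ` for the fibre
integrals, once `D` is absorbed into one factor. -/
theorem PrekopaLeindler.prod {V W : Type*} [Add V] [Add W] [MeasurableSpace V] [MeasurableSpace W]
    {μ : Measure V} {ν : Measure W} [SFinite μ] [SFinite ν] {C D : ℝ≥0∞}
    (hμ : PrekopaLeindler μ C) (hν : PrekopaLeindler ν D) :
    PrekopaLeindler (μ.prod ν) (C * D) := by
  intro f g h hf hg hh H
  rw [lintegral_prod _ hf.aemeasurable, lintegral_prod _ hg.aemeasurable,
    lintegral_prod _ hh.aemeasurable]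
  have := hμ (fun x => ∫⁻ y, f (x, y) ∂ν) (fun x => D * ∫⁻ y, g (x, y) ∂ν)
    (fun x => ∫⁻ y, h (x, y) ∂ν) hf.lintegral_prod_right' (hg.lintegral_prod_right'.const_mul D)
    hh.lintegral_prod_right' (fun x x' => by
      have := hν (fun y => f (x, y)) (fun y => g (x', y)) (fun y => h (x + x', y))
        (by fun_prop) (by fun_prop) (by fun_prop) (fun y y' => H (x, y) (x', y'))
      refine le_trans (le_of_eq ?_) this
      ring)
  rw [lintegral_const_mul _ hg.lintegral_prod_right'] at this
  refine le_trans (le_of_eq ?_) this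
  ring

theorem PrekopaLeindler.of_measurePreserving {V W : Type*} [Add V] [Add W] [MeasurableSpace V]
    [MeasurableSpace W] {μ : Measure V} {ν : Measure W} {C : ℝ≥0∞} (hμ : PrekopaLeindler μ C)
    (e : V → W) (he : MeasurePreserving e μ ν) (hadd : ∀ x y, e (x + y) = e x + e y) :
    PrekopaLeindler ν C := by
  intro f g h hf hg hh H
  rw [← he.lintegral_comp hf, ← he.lintegral_comp hg, ← he.lintegral_comp hh]
  exact hμ _ _ _ (hf.comp he.measurable) (hg.comp he.measurable) (hh.comp he.measurable)
    fun x y => by simpa only [hadd] using H (e x) (e y)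

theorem prekopaLeindler_pi (n : ℕ) : PrekopaLeindler (volume : Measure (Fin n → ℝ)) (4 ^ n) := by
  induction n with
  | zero =>
    intro f g h hf hg hh H
    have := H default default
    rw [Subsingleton.elim (default + default : Fin 0 → ℝ) default] at this
    simp only [lintegral_unique, volume_pi, pow_zero, one_mul, Measure.pi_univ,
      Finset.univ_eq_empty, Finset.prod_empty, mul_one]
    convert! this
  | succ n ih =>
    rw [pow_succ']
    refine (prekopaLeindler_real.prod ih).of_measurePreserving
      (MeasurableEquiv.piFinSuccAbove (fun _ => ℝ) 0).symm
      (volume_preserving_piFinSuccAbove (fun _ => ℝ) 0).symm ?_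
    intro x y
    ext i
    refine Fin.cases ?_ (fun j => ?_) i <;> simp [MeasurableEquiv.piFinSuccAbove]

theorem prekopaLeindler_euclideanSpace (n : ℕ) :
    PrekopaLeindler (volume : Measure (EuclideanSpace ℝ (Fin n))) (4 ^ n) :=
  (prekopaLeindler_pi n).of_measurePreserving (WithLp.toLp 2)
    (PiLp.volume_preserving_toLp (Fin n)) fun _ _ => rfl

/-! ### The isodiametric inequality. -/

theorem omega_pos (n : ℕ) : 0 < omega n := by
  unfold omega
  have : 0 < Real.Gamma (1 + n / 2) := Real.Gamma_pos_of_pos (by positivity)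
  positivity

theorem volume_closedBall_eq_omega {n : ℕ} (hn : 1 ≤ n) (x : EuclideanSpace ℝ (Fin n)) (r : ℝ) :
    volume (Metric.closedBall x r) = ENNReal.ofReal (omega n) * ENNReal.ofReal r ^ n := by
  have : Nonempty (Fin n) := ⟨⟨0, hn⟩⟩
  rw [EuclideanSpace.volume_closedBall, mul_comm, Fintype.card_fin]
  congr 2
  unfold omega
  rw [add_comm, Real.sqrt_eq_rpow, ← Real.rpow_mul_natCast Real.pi_pos.le]
  congr 2
  ring

/-- The isodiametric inequality. -/
theorem volume_le_ediam_pow {n : ℕ} (hn : 1 ≤ n) (s : Set (EuclideanSpace ℝ (Fin n))) :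
    volume s ≤ ENNReal.ofReal (omega n / 2 ^ n) * Metric.ediam s ^ n := by
  have hpos : ENNReal.ofReal (omega n / 2 ^ n) ≠ 0 := by
    have := omega_pos n
    simp only [ne_eq, ENNReal.ofReal_eq_zero, not_le]; positivity
  rcases eq_or_ne (Metric.ediam s) ∞ with hs | hs
  · rw [hs, ENNReal.top_pow (by omega), ENNReal.mul_top hpos]; exact le_top
  set K := closure s with hK
  have hKs : Metric.ediam K = Metric.ediam s := Metric.ediam_closure s
  refine (measure_mono subset_closure).trans ?_
  rw [← hKs] at hs ⊢
  have hKm : MeasurableSet K := isClosed_closure.measurableSet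
  -- A point of `K` plus a point of `-K` is a difference of points of `K`, of norm at most `diam K`.
  -- This yields `4ⁿ |K|² ≤ |B(0, diam K)|²`.
  have := prekopaLeindler_euclideanSpace n (K.indicator 1) ((-K).indicator 1)
    ((Metric.closedBall 0 (Metric.diam K)).indicator 1)
    (measurable_one.indicator hKm) (measurable_one.indicator hKm.neg)
    (measurable_one.indicator Metric.isClosed_closedBall.measurableSet) (by
      intro x y
      by_cases hx : x ∈ K
      · by_cases hy : y ∈ -K
        · have : x + y ∈ Metric.closedBall 0 (Metric.diam K) := by
            rw [mem_closedBall_zero_iff]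
            have := Metric.dist_le_diam_of_mem' hs hx hy
            rwa [dist_eq_norm, sub_neg_eq_add] at this
          rw [Set.indicator_of_mem this]
          simpa using mul_le_one' (Set.indicator_le_self' (by simp) x)
            (Set.indicator_le_self' (by simp) y)
        · simp [hy]
      · simp [hx])
  rw [lintegral_indicator_one hKm, lintegral_indicator_one hKm.neg,
    lintegral_indicator_one Metric.isClosed_closedBall.measurableSet, Measure.measure_neg,
    volume_closedBall_eq_omega hn, Metric.diam, ENNReal.ofReal_toReal hs] at this
  have h2 : ((2 : ℝ≥0∞) ^ n * volume K) ^ 2 ≤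
      (ENNReal.ofReal (omega n) * Metric.ediam K ^ n) ^ 2 := by
    refine le_trans (le_of_eq ?_) this
    rw [mul_pow, ← pow_mul, mul_comm n, pow_mul, ← sq]
    norm_num
  have h3 := (ENNReal.pow_le_pow_left_iff (two_ne_zero)).1 h2
  rw [ENNReal.ofReal_div_of_pos (by positivity), ENNReal.ofReal_pow (by norm_num)]
  simp only [ENNReal.ofReal_ofNat]
  rw [ENNReal.div_eq_inv_mul, mul_assoc]
  rw [← ENNReal.inv_mul_le_iff (by simp) (by simp), inv_inv]
  exact h3

/-! ### Hausdorff measure equals Lebesgue measure on `ℝᵏ`. -/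

theorem ofReal_omega_div_ne_zero (k : ℕ) : ENNReal.ofReal (omega k / 2 ^ k) ≠ 0 := by
  have := omega_pos k
  simp only [ne_eq, ENNReal.ofReal_eq_zero, not_le]
  positivity

theorem omega_mul_ediam_closedBall_pow_le {k : ℕ} (hk : 1 ≤ k) (x : EuclideanSpace ℝ (Fin k))
    (r : ℝ) : ENNReal.ofReal (omega k / 2 ^ k) * Metric.ediam (Metric.closedBall x r) ^ k ≤
      volume (Metric.closedBall x r) := by
  have h : Metric.ediam (Metric.closedBall x r) ≤ 2 * ENNReal.ofReal r := by
    rcases le_or_gt 0 r with hr | hr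
    · rw [← Metric.closedEBall_ofReal hr]
      exact Metric.ediam_closedEBall_le
    · simp [Metric.closedBall_eq_empty.2 hr]
  rw [volume_closedBall_eq_omega hk]
  calc _ ≤ ENNReal.ofReal (omega k / 2 ^ k) * (2 * ENNReal.ofReal r) ^ k := by gcongr
    _ = ENNReal.ofReal (omega k) * ENNReal.ofReal r ^ k := by
      rw [ENNReal.ofReal_div_of_pos (by positivity), ENNReal.ofReal_pow (by norm_num),
        mul_pow, ← mul_assoc, ENNReal.ofReal_ofNat,
        ENNReal.div_mul_cancel (by simp) (by simp)]

/-- Disjoint closed balls of arbitrarily small radius fill the ball up to a Lebesgue-null set, and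
for balls the normalised `diamᵏ` is at most the volume. The Haar property serves to make the
leftover set null for the Hausdorff measure too. -/
theorem hausdorffMeasure_ball_le {k : ℕ} (hk : 1 ≤ k)
    [(Measure.hausdorffMeasure k : Measure (EuclideanSpace ℝ (Fin k))).IsAddHaarMeasure]
    (x₀ : EuclideanSpace ℝ (Fin k)) (R : ℝ) :
    ENNReal.ofReal (omega k / 2 ^ k) * Measure.hausdorffMeasure k (Metric.ball x₀ R) ≤
      volume (Metric.ball x₀ R) := by
  set U := Metric.ball x₀ R
  set c := ENNReal.ofReal (omega k / 2 ^ k)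
  have hac : (Measure.hausdorffMeasure k : Measure (EuclideanSpace ℝ (Fin k))) ≪ volume :=
    Measure.absolutelyContinuous_isAddHaarMeasure _ _
  have hcov (m : ℕ) := Besicovitch.exists_disjoint_closedBall_covering_ae
    (volume : Measure (EuclideanSpace ℝ (Fin k))) (fun x => {r | Metric.closedBall x r ⊆ U}) U
    (fun x hx δ hδ => by
      obtain ⟨ε, hε, hεU⟩ := Metric.nhds_basis_closedBall.mem_iff.1
        (Metric.isOpen_ball.mem_nhds hx)
      refine ⟨min ε (δ / 2), ?_, by positivity, (min_le_right _ _).trans_lt (by linarith)⟩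
      exact (Metric.closedBall_subset_closedBall (min_le_left _ _)).trans hεU)
    (fun _ => 1 / ((m : ℝ) + 1)) (fun _ _ => by positivity)
  choose t r ht htU hr hnull hdisj using hcov
  set N : Set (EuclideanSpace ℝ (Fin k)) :=
    ⋃ m, U \ ⋃ x ∈ t m, Metric.closedBall x (r m x)
  have hN : Measure.hausdorffMeasure k N = 0 := by
    rw [measure_iUnion_null_iff]
    exact fun m => hac (hnull m)
  have hle : Measure.hausdorffMeasure k U ≤ Measure.hausdorffMeasure k (U \ N) := by
    calc _ ≤ Measure.hausdorffMeasure k ((U \ N) ∪ N) := measure_mono (by simp)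
      _ ≤ _ := measure_union_le _ _
      _ = _ := by rw [hN, add_zero]
  have : ∀ m, Countable (t m) := fun m => (ht m).to_subtype
  have hlim := Measure.hausdorffMeasure_le_liminf_tsum (k : ℝ) (U \ N) (l := Filter.atTop)
    (fun m : ℕ => 2 * ENNReal.ofReal (1 / ((m : ℝ) + 1)))
    (by
      have := ENNReal.tendsto_ofReal tendsto_one_div_add_atTop_nhds_zero_nat
      have := ENNReal.Tendsto.const_mul (a := 2) this (.inr (by simp))
      simpa using this)
    (fun m (x : t m) => Metric.closedBall (x : EuclideanSpace ℝ (Fin k)) (r m x))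
    (.of_forall fun m x => by
      have hx := hr m x x.2
      have h0 : 0 ≤ r m x := hx.2.1.le
      rw [← Metric.closedEBall_ofReal h0]
      refine Metric.ediam_closedEBall_le.trans ?_
      gcongr
      exact hx.2.2.le)
    (.of_forall fun m y hy => by
      have h2 : y ∉ U \ ⋃ x ∈ t m, Metric.closedBall x (r m x) := fun h =>
        hy.2 (Set.mem_iUnion.2 ⟨m, h⟩)
      have h3 : y ∈ ⋃ x ∈ t m, Metric.closedBall x (r m x) := by
        by_contra h; exact h2 ⟨hy.1, h⟩
      simpa using h3)
  have hbound : ∀ m, ∑' x : t m,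
      Metric.ediam (Metric.closedBall (x : EuclideanSpace ℝ (Fin k)) (r m x)) ^ (k : ℝ) ≤
        c⁻¹ * volume U := by
    intro m
    have h1 : ∑' x : t m, volume (Metric.closedBall (x : EuclideanSpace ℝ (Fin k)) (r m x)) ≤
        volume U := by
      rw [← measure_biUnion (ht m) (hdisj m) fun x _ => Metric.isClosed_closedBall.measurableSet]
      exact measure_mono (Set.iUnion₂_subset fun x hx => (hr m x hx).1)
    refine le_trans ?_ (mul_le_mul_right h1 c⁻¹)
    rw [← ENNReal.tsum_mul_left]
    refine ENNReal.tsum_le_tsum fun x => ?_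
    rw [ENNReal.rpow_natCast, ← ENNReal.mul_le_iff_le_inv (ofReal_omega_div_ne_zero k) (by simp)]
    exact omega_mul_ediam_closedBall_pow_le hk _ _
  rw [ENNReal.mul_le_iff_le_inv (ofReal_omega_div_ne_zero k) (by simp)]
  refine hle.trans (hlim.trans ?_)
  refine (Filter.liminf_le_liminf (.of_forall hbound)).trans ?_
  simp [c]

/-- On `ℝᵏ` the normalised `k`-dimensional Hausdorff measure is Lebesgue measure. -/
theorem smul_hausdorffMeasure_eq_volume {k : ℕ} (hk : 1 ≤ k) :
    ENNReal.ofReal (omega k / 2 ^ k) •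
      (Measure.hausdorffMeasure k : Measure (EuclideanSpace ℝ (Fin k))) = volume := by
  have hc0 := ofReal_omega_div_ne_zero k
  have hct : ENNReal.ofReal (omega k / 2 ^ k) ≠ ∞ := by simp
  have hH : (Measure.hausdorffMeasure k :
      Measure (EuclideanSpace ℝ (Fin k))).IsAddHaarMeasure := by
    have := isAddHaarMeasure_hausdorffMeasure (E := EuclideanSpace ℝ (Fin k))
    rwa [finrank_euclideanSpace_fin] at this
  have hball := hausdorffMeasure_ball_le hk 0 1
  set c := ENNReal.ofReal (omega k / 2 ^ k)
  refine le_antisymm ?_ ?_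
  -- By uniqueness of Haar measure the two measures are proportional, so testing on the unit ball
  -- suffices.
  · have h := Measure.isAddLeftInvariant_eq_smul
      (Measure.hausdorffMeasure k : Measure (EuclideanSpace ℝ (Fin k))) volume
    set C := Measure.addHaarScalarFactor
      (Measure.hausdorffMeasure k : Measure (EuclideanSpace ℝ (Fin k))) volume
    rw [h] at hball ⊢
    have h1 : c * C ≤ 1 := by
      rw [Measure.smul_apply, ENNReal.smul_def, smul_eq_mul, ← mul_assoc] at hball
      have hB0 : volume (Metric.ball (0 : EuclideanSpace ℝ (Fin k)) 1) ≠ 0 :=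
        (Metric.measure_ball_pos _ _ one_pos).ne'
      have hBt : volume (Metric.ball (0 : EuclideanSpace ℝ (Fin k)) 1) ≠ ∞ :=
        measure_ball_lt_top.ne
      rw [← ENNReal.mul_le_mul_iff_left hB0 hBt]
      simpa using hball
    intro s
    simp only [Measure.smul_apply, ENNReal.smul_def, smul_eq_mul, ← mul_assoc]
    exact mul_le_of_le_one_left' h1
  -- The isodiametric inequality bounds the rescaled volume of every set by `diamᵏ`, which passes to
  -- the Hausdorff measure.
  · have h : c⁻¹ • (volume : Measure (EuclideanSpace ℝ (Fin k))) ≤ Measure.hausdorffMeasure k := by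
      refine Measure.le_hausdorffMeasure _ _ 1 one_pos fun s _ => ?_
      rw [Measure.smul_apply, smul_eq_mul, ENNReal.rpow_natCast, ENNReal.inv_mul_le_iff hc0 hct]
      exact volume_le_ediam_pow hk s
    intro s
    have := h s
    rw [Measure.smul_apply, smul_eq_mul] at this ⊢
    rwa [ENNReal.inv_mul_le_iff hc0 hct] at this

/-! ### Lipschitz comparison of images. -/

/-- The normalised `k`-dimensional Hausdorff measure on the Borel sets of `ℝⁿ`. -/
noncomputable def hausdorffBorel (n k : ℕ) : Measure (EuclideanSpace ℝ (Fin n)) :=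
  ENNReal.ofReal (omega k / 2 ^ k) • Measure.hausdorffMeasure k

/-- On `s` the map `f` factors as `φ ∘ g` with `φ` Lipschitz on `g '' s`. Injectivity of `g` is not
needed: the hypothesis forces `f` to agree wherever `g` does. -/
theorem hausdorffMeasure_image_le_of_edist_le {X Y Z : Type*} [EMetricSpace X] [EMetricSpace Y]
    [MeasurableSpace X] [BorelSpace X] [MeasurableSpace Y] [BorelSpace Y] {f : Z → X} {g : Z → Y}
    {s : Set Z} {K : ℝ≥0} (h : ∀ x ∈ s, ∀ y ∈ s, edist (f x) (f y) ≤ K * edist (g x) (g y))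
    {d : ℝ} (hd : 0 ≤ d) :
    Measure.hausdorffMeasure d (f '' s) ≤ (K : ℝ≥0∞) ^ d * Measure.hausdorffMeasure d (g '' s) := by
  rcases s.eq_empty_or_nonempty with rfl | ⟨z, hz⟩
  · simp
  have : Nonempty Z := ⟨z⟩
  set φ : Y → X := f ∘ Function.invFunOn g s
  have hmem : ∀ x ∈ s, Function.invFunOn g s (g x) ∈ s := fun x hx =>
    Function.invFunOn_mem ⟨x, hx, rfl⟩
  have heq : ∀ x ∈ s, g (Function.invFunOn g s (g x)) = g x := fun x hx =>
    Function.invFunOn_eq ⟨x, hx, rfl⟩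
  have hφ : ∀ x ∈ s, φ (g x) = f x := fun x hx => by
    have := h _ (hmem x hx) x hx
    rw [heq x hx, edist_self, mul_zero, nonpos_iff_eq_zero, edist_eq_zero] at this
    exact this
  have hL : LipschitzOnWith K φ (g '' s) := by
    rintro _ ⟨x, hx, rfl⟩ _ ⟨y, hy, rfl⟩
    rw [hφ x hx, hφ y hy]
    exact h x hx y hy
  have := hL.hausdorffMeasure_image_le hd
  rwa [Set.image_image, Set.image_congr hφ] at this

theorem hausdorffBorel_image_le {Z : Type*} {n m k : ℕ} {f : Z → EuclideanSpace ℝ (Fin n)}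
    {g : Z → EuclideanSpace ℝ (Fin m)} {s : Set Z} {K : ℝ} (hK : 0 ≤ K)
    (h : ∀ x ∈ s, ∀ y ∈ s, ‖f x - f y‖ ≤ K * ‖g x - g y‖) :
    hausdorffBorel n k (f '' s) ≤ ENNReal.ofReal K ^ k * hausdorffBorel m k (g '' s) := by
  have := hausdorffMeasure_image_le_of_edist_le (f := f) (g := g) (s := s) (K := K.toNNReal)
    (fun x hx y hy => by
      rw [edist_dist, edist_dist, dist_eq_norm, dist_eq_norm]
      change _ ≤ ENNReal.ofReal K * _
      rw [← ENNReal.ofReal_mul hK]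
      exact ENNReal.ofReal_le_ofReal (h x hx y hy)) (d := k) (Nat.cast_nonneg k)
  rw [ENNReal.rpow_natCast] at this
  simp only [hausdorffBorel, Measure.smul_apply, smul_eq_mul]
  rw [mul_left_comm]
  exact mul_le_mul_right this _

theorem hausdorffBorel_self {k : ℕ} (hk : 1 ≤ k) : hausdorffBorel k k = volume :=
  smul_hausdorffMeasure_eq_volume hk

/-! ### Maps close to a linear map. -/

section Linear

variable {k n : ℕ}

/-- The Jacobian of the linear map `x ↦ (T x, η x)`. -/
noncomputable def regularizedJacobian
    (T : EuclideanSpace ℝ (Fin k) →L[ℝ] EuclideanSpace ℝ (Fin n)) (η : ℝ) : ℝ :=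
  √((ContinuousLinearMap.adjoint T ∘L T + η ^ 2 • ContinuousLinearMap.id ℝ (EuclideanSpace ℝ (Fin k))).det)

theorem regularizedJacobian_zero
    (T : EuclideanSpace ℝ (Fin k) →L[ℝ] EuclideanSpace ℝ (Fin n)) :
    regularizedJacobian T 0 = jacobianLinear T := by
  have h : (0 : ℝ) • ContinuousLinearMap.id ℝ (EuclideanSpace ℝ (Fin k)) = 0 := by ext x; simp
  rw [regularizedJacobian, jacobianLinear, zero_pow two_ne_zero, h, add_zero]

theorem continuous_regularizedJacobian
    (T : EuclideanSpace ℝ (Fin k) →L[ℝ] EuclideanSpace ℝ (Fin n)) :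
    Continuous (regularizedJacobian T) :=
  (ContinuousLinearMap.continuous_det.comp (by fun_prop)).sqrt

theorem continuous_jacobianLinear : Continuous (jacobianLinear (k := k) (n := n)) := by
  refine (ContinuousLinearMap.continuous_det.comp ?_).sqrt
  exact ((ContinuousLinearMap.adjoint (𝕜 := ℝ)).continuous).clm_comp continuous_id

theorem jacobianLinear_nonneg
    (T : EuclideanSpace ℝ (Fin k) →L[ℝ] EuclideanSpace ℝ (Fin n)) : 0 ≤ jacobianLinear T :=
  Real.sqrt_nonneg _

theorem exists_adjoint_comp_self_eq {P : EuclideanSpace ℝ (Fin k) →L[ℝ] EuclideanSpace ℝ (Fin k)}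
    (hP : P.IsPositive) :
    ∃ S : EuclideanSpace ℝ (Fin k) →L[ℝ] EuclideanSpace ℝ (Fin k),
      ContinuousLinearMap.adjoint S ∘L S = P := by
  obtain ⟨M, rfl⟩ : ∃ M, Matrix.toEuclideanCLM (𝕜 := ℝ) (n := Fin k) M = P :=
    ⟨_, StarAlgEquiv.apply_symm_apply _ P⟩
  have hM : M.PosSemidef := by
    rw [← Matrix.isPositive_toEuclideanLin_iff, ← Matrix.coe_toEuclideanCLM_eq_toEuclideanLin]
    exact hP
  open MatrixOrder in
  obtain ⟨B, rfl⟩ := CStarAlgebra.nonneg_iff_eq_star_mul_self.mp hM.nonneg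
  refine ⟨Matrix.toEuclideanCLM (𝕜 := ℝ) B, ?_⟩
  rw [map_mul, map_star]
  rfl

/-- Replaces `T` by an endomorphism `S` of `ℝᵏ` with `S* S = T* T + η²`, to which the determinant
formula for volumes applies. For `η ≠ 0` it is injective even when `T` is not. -/
theorem exists_norm_sq_eq (T : EuclideanSpace ℝ (Fin k) →L[ℝ] EuclideanSpace ℝ (Fin n)) (η : ℝ) :
    ∃ S : EuclideanSpace ℝ (Fin k) →L[ℝ] EuclideanSpace ℝ (Fin k),
      (∀ x, ‖S x‖ ^ 2 = ‖T x‖ ^ 2 + η ^ 2 * ‖x‖ ^ 2) ∧ |S.det| = regularizedJacobian T η := by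
  obtain ⟨S, hS⟩ := exists_adjoint_comp_self_eq
    (P := ContinuousLinearMap.adjoint T ∘L T + η ^ 2 • ContinuousLinearMap.id ℝ (EuclideanSpace ℝ (Fin k)))
    ((ContinuousLinearMap.isPositive_adjoint_comp_self T).add
      (ContinuousLinearMap.isPositive_id.smul_of_nonneg (sq_nonneg η)))
  refine ⟨S, fun x => ?_, ?_⟩
  · have h := congrArg (fun Q => inner ℝ (Q x) x) hS
    simp only [ContinuousLinearMap.comp_apply, _root_.add_apply,
      _root_.smul_apply, ContinuousLinearMap.id_apply, inner_add_left,
      ContinuousLinearMap.adjoint_inner_left, real_inner_self_eq_norm_sq,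
      real_inner_smul_left] at h
    exact h
  · rw [regularizedJacobian, ← hS]
    have h := S.normDet_sq
    rw [LinearMap.normDet_eq_abs_det] at h
    rw [show (ContinuousLinearMap.adjoint S ∘L S).det = |S.det| ^ 2 from h.symm,
      Real.sqrt_sq (abs_nonneg _)]

theorem hausdorffBorel_image_continuousLinearMap (hk : 1 ≤ k)
    (S : EuclideanSpace ℝ (Fin k) →L[ℝ] EuclideanSpace ℝ (Fin k))
    (s : Set (EuclideanSpace ℝ (Fin k))) :
    hausdorffBorel k k (S '' s) = ENNReal.ofReal |S.det| * volume s := by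
  rw [hausdorffBorel_self hk, Measure.addHaar_image_continuousLinearMap]

theorem exists_forall_hausdorffBorel_image_le (hk : 1 ≤ k)
    (A : EuclideanSpace ℝ (Fin k) →L[ℝ] EuclideanSpace ℝ (Fin n)) {ε : ℝ} (hε : 0 < ε) :
    ∃ δ : ℝ≥0, 0 < δ ∧ ∀ (f : EuclideanSpace ℝ (Fin k) → EuclideanSpace ℝ (Fin n))
      (s : Set (EuclideanSpace ℝ (Fin k))), ApproximatesLinearOn f A s δ →
        hausdorffBorel n k (f '' s) ≤ ENNReal.ofReal (jacobianLinear A + ε) * volume s := by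
  obtain ⟨η, hη, hη0⟩ : ∃ η, regularizedJacobian A η < jacobianLinear A + ε ∧ 0 < η := by
    have h : ∀ᶠ η in nhds (0 : ℝ), regularizedJacobian A η < jacobianLinear A + ε := by
      refine (continuous_regularizedJacobian A).continuousAt.eventually_lt_const ?_
      rw [regularizedJacobian_zero]; linarith
    exact ((h.filter_mono nhdsWithin_le_nhds).and (self_mem_nhdsWithin (s := Set.Ioi 0))).exists
  obtain ⟨S, hS, hdet⟩ := exists_norm_sq_eq A η
  obtain ⟨t, ht, ht0⟩ : ∃ t, (1 + t) ^ k * |S.det| < jacobianLinear A + ε ∧ 0 < t := by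
    have h : ∀ᶠ t in nhds (0 : ℝ), (1 + t) ^ k * |S.det| < jacobianLinear A + ε := by
      have hc : Continuous fun t : ℝ => (1 + t) ^ k * |S.det| := by fun_prop
      refine hc.continuousAt.eventually_lt_const ?_
      simpa [hdet] using hη
    exact ((h.filter_mono nhdsWithin_le_nhds).and (self_mem_nhdsWithin (s := Set.Ioi 0))).exists
  -- Since `η ‖x‖ ≤ ‖S x‖`, an error `t η ‖x - y‖` is at most `t ‖S (x - y)‖`, so `f` is `(1 +
  -- t)`-Lipschitz relative to `S`.
  refine ⟨⟨t * η, by positivity⟩, NNReal.coe_pos.1 (mul_pos ht0 hη0),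
    fun f s hf => ?_⟩
  have h1 : ∀ x ∈ s, ∀ y ∈ s, ‖f x - f y‖ ≤ (1 + t) * ‖S x - S y‖ := by
    intro x hx y hy
    have ha : ‖A (x - y)‖ ≤ ‖S (x - y)‖ := by
      refine (pow_le_pow_iff_left₀ (norm_nonneg _) (norm_nonneg _) two_ne_zero).1 ?_
      rw [hS]; nlinarith [sq_nonneg (η * ‖x - y‖)]
    have hb : η * ‖x - y‖ ≤ ‖S (x - y)‖ := by
      refine (pow_le_pow_iff_left₀ (by positivity) (norm_nonneg _) two_ne_zero).1 ?_
      rw [hS]; nlinarith [sq_nonneg ‖A (x - y)‖]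
    have hc : ‖f x - f y - A (x - y)‖ ≤ t * η * ‖x - y‖ := hf x hx y hy
    have hd : ‖f x - f y‖ ≤ ‖f x - f y - A (x - y)‖ + ‖A (x - y)‖ := by
      simpa using norm_add_le (f x - f y - A (x - y)) (A (x - y))
    rw [← map_sub]
    nlinarith
  refine (hausdorffBorel_image_le (by positivity) h1).trans ?_
  rw [hausdorffBorel_image_continuousLinearMap hk, ← mul_assoc, ← ENNReal.ofReal_pow (by positivity),
    ← ENNReal.ofReal_mul (by positivity)]
  gcongr

/-- With `J(A) ≠ 0` no regularisation is needed: `S` is invertible and `‖S x‖ = ‖A x‖`. A small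
error then leaves `f` expanding by at least `1 - t` relative to `S`, which gives both injectivity
and the lower bound. -/
theorem exists_forall_le_hausdorffBorel_image (hk : 1 ≤ k)
    (A : EuclideanSpace ℝ (Fin k) →L[ℝ] EuclideanSpace ℝ (Fin n)) (hA : jacobianLinear A ≠ 0)
    {ε : ℝ} (hε : 0 < ε) :
    ∃ δ : ℝ≥0, 0 < δ ∧ ∀ (f : EuclideanSpace ℝ (Fin k) → EuclideanSpace ℝ (Fin n))
      (s : Set (EuclideanSpace ℝ (Fin k))), ApproximatesLinearOn f A s δ →
        Set.InjOn f s ∧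
        ENNReal.ofReal (jacobianLinear A) * volume s ≤
          hausdorffBorel n k (f '' s) + ENNReal.ofReal ε * volume s := by
  have hJ := (jacobianLinear_nonneg A).lt_of_ne' hA
  obtain ⟨S, hS, hdet⟩ := exists_norm_sq_eq A 0
  rw [regularizedJacobian_zero] at hdet
  have hSA : ∀ x, ‖S x‖ = ‖A x‖ := fun x => by
    have := hS x
    rwa [zero_pow two_ne_zero, zero_mul, add_zero,
      pow_left_inj₀ (norm_nonneg _) (norm_nonneg _) two_ne_zero] at this
  have hSdet : S.det ≠ 0 := abs_pos.1 (hdet ▸ hJ)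
  obtain ⟨C, hC0, hC⟩ : ∃ C : ℝ, 0 < C ∧ ∀ x, ‖x‖ ≤ C * ‖S x‖ := by
    let e := S.toContinuousLinearEquivOfDetNeZero hSdet
    let e' : EuclideanSpace ℝ (Fin k) →L[ℝ] EuclideanSpace ℝ (Fin k) := e.symm
    refine ⟨‖e'‖ + 1, by positivity, fun x => ?_⟩
    have h : ‖e.symm (e x)‖ ≤ ‖e'‖ * ‖e x‖ := e'.le_opNorm (e x)
    rw [e.symm_apply_apply] at h
    exact h.trans (mul_le_mul_of_nonneg_right (by linarith) (norm_nonneg (S x)))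
  obtain ⟨t, ⟨ht, ht1⟩, ht0⟩ :
      ∃ t, (jacobianLinear A - ε < (1 - t) ^ k * jacobianLinear A ∧ t < 1) ∧ 0 < t := by
    have h : ∀ᶠ t in nhds (0 : ℝ), jacobianLinear A - ε < (1 - t) ^ k * jacobianLinear A := by
      have hc : Continuous fun t : ℝ => (1 - t) ^ k * jacobianLinear A := by fun_prop
      refine hc.continuousAt.eventually_const_lt ?_
      simpa using hε
    have h' := h.and (eventually_lt_nhds (zero_lt_one (α := ℝ)))
    exact ((h'.filter_mono nhdsWithin_le_nhds).and (self_mem_nhdsWithin (s := Set.Ioi 0))).exists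
  have ht1' : 0 < 1 - t := by linarith
  refine ⟨⟨t / C, by positivity⟩, NNReal.coe_pos.1 (div_pos ht0 hC0), fun f s hf => ?_⟩
  have h1 : ∀ x ∈ s, ∀ y ∈ s, (1 - t) * ‖S x - S y‖ ≤ ‖f x - f y‖ := by
    intro x hx y hy
    have hc : ‖f x - f y - A (x - y)‖ ≤ t / C * ‖x - y‖ := hf x hx y hy
    have hd : ‖A (x - y)‖ ≤ ‖f x - f y‖ + ‖f x - f y - A (x - y)‖ := by
      simpa using norm_sub_le (f x - f y) (f x - f y - A (x - y))
    have he : t / C * ‖x - y‖ ≤ t * ‖S (x - y)‖ := by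
      rw [div_mul_eq_mul_div, div_le_iff₀ hC0, mul_assoc, mul_comm _ C]
      exact mul_le_mul_of_nonneg_left (hC _) ht0.le
    rw [← map_sub]
    rw [← hSA] at hd
    linarith
  refine ⟨fun x hx y hy hxy => ?_, ?_⟩
  · have h2 := h1 x hx y hy
    rw [hxy, sub_self, norm_zero, ← map_sub] at h2
    have h3 := hC (x - y)
    have h4 : ‖S (x - y)‖ ≤ 0 := by nlinarith [norm_nonneg (S (x - y))]
    have h5 : ‖x - y‖ ≤ 0 := by nlinarith
    exact sub_eq_zero.1 (norm_le_zero_iff.1 h5)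
  · have h2 := hausdorffBorel_image_le (k := k) (f := S) (g := f) (s := s) (K := (1 - t)⁻¹)
      (by positivity) (fun x hx y hy => by
        rw [inv_mul_eq_div, le_div_iff₀ ht1', mul_comm]; exact h1 x hx y hy)
    rw [hausdorffBorel_image_continuousLinearMap hk, hdet] at h2
    have h3 : ENNReal.ofReal ((1 - t) ^ k * jacobianLinear A) * volume s ≤
        hausdorffBorel n k (f '' s) := by
      rw [ENNReal.ofReal_mul (by positivity), mul_assoc]
      refine (mul_le_mul_right h2 _).trans (le_of_eq ?_)
      rw [← mul_assoc, ENNReal.ofReal_pow ht1'.le, ← mul_pow, ← ENNReal.ofReal_mul ht1'.le,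
        mul_inv_cancel₀ ht1'.ne']
      simp
    calc _ ≤ ENNReal.ofReal ((1 - t) ^ k * jacobianLinear A + ε) * volume s := by
          gcongr; linarith
      _ ≤ _ := by
          rw [ENNReal.ofReal_add (by positivity) hε.le, add_mul]
          gcongr

end Linear

/-! ### The area formula on sets of differentiability points. -/

section Differentiable

variable {k n : ℕ} {f : EuclideanSpace ℝ (Fin k) → EuclideanSpace ℝ (Fin n)}
  {s : Set (EuclideanSpace ℝ (Fin k))}

theorem measurable_jacobian : Measurable (jacobian f) :=
  continuous_jacobianLinear.measurable.comp (measurable_fderiv ℝ f)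

theorem jacobian_nonneg (x : EuclideanSpace ℝ (Fin k)) : 0 ≤ jacobian f x :=
  jacobianLinear_nonneg _

/-- A measurable set of differentiability points splits into countably many pieces on which the
area formula holds up to an error `ε` per unit volume. -/
theorem exists_partition_area_approx (hk : 1 ≤ k) (hs : MeasurableSet s)
    (hf : ∀ x ∈ s, DifferentiableAt ℝ f x) {ε : ℝ} (hε : 0 < ε) :
    ∃ p : ℕ × ℕ → Set (EuclideanSpace ℝ (Fin k)), Pairwise (Function.onFun Disjoint p) ∧
      (∀ i, MeasurableSet (p i)) ∧ ⋃ i, p i = s ∧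
      (∀ i, hausdorffBorel n k (f '' p i) ≤ (∫⁻ x in p i, ENNReal.ofReal (jacobian f x)) +
        ENNReal.ofReal (2 * ε) * volume (p i)) ∧
      ((∀ x ∈ s, jacobian f x ≠ 0) → ∀ i, Set.InjOn f (p i) ∧
        ∫⁻ x in p i, ENNReal.ofReal (jacobian f x) ≤ hausdorffBorel n k (f '' p i) +
          ENNReal.ofReal (2 * ε) * volume (p i)) := by
  choose δ₁ hδ₁ hup using fun A => exists_forall_hausdorffBorel_image_le (n := n) hk A hε
  have hlow' : ∀ A : EuclideanSpace ℝ (Fin k) →L[ℝ] EuclideanSpace ℝ (Fin n), ∃ δ : ℝ≥0, 0 < δ ∧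
      (jacobianLinear A ≠ 0 → ∀ (f : EuclideanSpace ℝ (Fin k) → EuclideanSpace ℝ (Fin n))
      (s : Set (EuclideanSpace ℝ (Fin k))), ApproximatesLinearOn f A s δ →
        Set.InjOn f s ∧
        ENNReal.ofReal (jacobianLinear A) * volume s ≤
          hausdorffBorel n k (f '' s) + ENNReal.ofReal ε * volume s) := by
    intro A
    by_cases hA : jacobianLinear A = 0
    · exact ⟨1, one_pos, fun h => absurd hA h⟩
    · obtain ⟨δ, h, h'⟩ := exists_forall_le_hausdorffBorel_image hk A hA hε
      exact ⟨δ, h, fun _ => h'⟩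
  choose δ₂ hδ₂ hlow using hlow'
  -- Slicing by the value of the Jacobian makes it vary by less than `ε` on each slice. The
  -- approximating linear maps are derivatives at points of the slice, so their Jacobians are within
  -- `ε` as well.
  set q : ℕ → Set (EuclideanSpace ℝ (Fin k)) := fun j => s ∩ {x | ⌊jacobian f x / ε⌋₊ = j}
  have hqm : ∀ j, MeasurableSet (q j) := fun j =>
    hs.inter ((Nat.measurable_floor.comp (measurable_jacobian.div_const ε))
      (measurableSet_singleton j))
  have hpart (j : ℕ) := exists_partition_approximatesLinearOn_of_hasFDerivWithinAt f (q j)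
    (fderiv ℝ f) (fun x hx => (hf x hx.1).hasFDerivAt.hasFDerivWithinAt)
    (fun A => min (δ₁ A) (δ₂ A)) (fun A => (lt_min (hδ₁ A) (hδ₂ A)).ne')
  choose t A htd htm htc hta htA using hpart
  have hclose : ∀ j m x, x ∈ q j ∩ t j m →
      jacobianLinear (A j m) ≤ jacobian f x + ε ∧ jacobian f x ≤ jacobianLinear (A j m) + ε ∧
      ∃ y ∈ s, jacobianLinear (A j m) = jacobian f y := by
    intro j m x hx
    obtain ⟨y, hy, hyA⟩ := htA j ⟨x, hx.1⟩ m
    have hAy : jacobianLinear (A j m) = jacobian f y := by rw [hyA]; rfl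
    have h1 := (Nat.floor_eq_iff (div_nonneg (jacobian_nonneg x) hε.le)).1 hx.1.2
    have h2 := (Nat.floor_eq_iff (div_nonneg (jacobian_nonneg y) hε.le)).1 hy.2
    rw [le_div_iff₀ hε, div_lt_iff₀ hε] at h1 h2
    rw [hAy]
    exact ⟨by linarith, by linarith, y, hy.1, rfl⟩
  have hpm : ∀ i : ℕ × ℕ, MeasurableSet (q i.1 ∩ t i.1 i.2) := fun i =>
    (hqm i.1).inter (htm i.1 i.2)
  refine ⟨fun i => q i.1 ∩ t i.1 i.2, ?_, hpm, ?_, ?_, ?_⟩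
  · rintro ⟨j, m⟩ ⟨j', m'⟩ hne
    rw [Function.onFun, Set.disjoint_left]
    rintro x ⟨⟨_, hx⟩, hx'⟩ ⟨⟨_, hy⟩, hy'⟩
    obtain rfl : j = j' := hx.symm.trans hy
    have hm : m ≠ m' := fun h => hne (by rw [h])
    exact Set.disjoint_left.1 (htd j hm) hx' hy'
  · refine Set.Subset.antisymm (Set.iUnion_subset fun i x hx => hx.1.1) fun x hx => ?_
    have hxq : x ∈ q ⌊jacobian f x / ε⌋₊ := ⟨hx, rfl⟩
    obtain ⟨m, hm⟩ := Set.mem_iUnion.1 (htc _ hxq)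
    exact Set.mem_iUnion.2 ⟨(_, m), hxq, hm⟩
  · rintro ⟨j, m⟩
    have h1 := hup (A j m) f (q j ∩ t j m) ((hta j m).mono_num (min_le_left _ _))
    refine h1.trans ?_
    rw [← setLIntegral_const, ← setLIntegral_const, ← lintegral_add_right _ measurable_const]
    refine setLIntegral_mono' (hpm (j, m)) fun x hx => ?_
    rw [← ENNReal.ofReal_add (jacobian_nonneg x) (by positivity)]
    exact ENNReal.ofReal_le_ofReal (by linarith [(hclose j m x hx).1])
  · rintro hJ ⟨j, m⟩
    rcases (q j ∩ t j m).eq_empty_or_nonempty with he | ⟨x, hx⟩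
    · simp [he]
    obtain ⟨y, hy, hAy⟩ := (hclose j m x hx).2.2
    obtain ⟨h1, h2⟩ := hlow (A j m) (hAy ▸ hJ y hy) f (q j ∩ t j m)
      ((hta j m).mono_num (min_le_right _ _))
    refine ⟨h1, ?_⟩
    calc ∫⁻ x in q j ∩ t j m, ENNReal.ofReal (jacobian f x)
        ≤ ∫⁻ x in q j ∩ t j m, (ENNReal.ofReal (jacobianLinear (A j m)) + ENNReal.ofReal ε) := by
          refine setLIntegral_mono' (hpm (j, m)) fun x hx => ?_
          rw [← ENNReal.ofReal_add (jacobianLinear_nonneg _) hε.le]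
          exact ENNReal.ofReal_le_ofReal (hclose j m x hx).2.1
      _ = ENNReal.ofReal (jacobianLinear (A j m)) * volume (q j ∩ t j m) +
          ENNReal.ofReal ε * volume (q j ∩ t j m) := by rw [setLIntegral_const, add_mul]
      _ ≤ hausdorffBorel n k (f '' (q j ∩ t j m)) + ENNReal.ofReal ε * volume (q j ∩ t j m) +
          ENNReal.ofReal ε * volume (q j ∩ t j m) := by gcongr
      _ = _ := by
          rw [add_assoc, ← add_mul, ← ENNReal.ofReal_add hε.le hε.le, ← two_mul]

theorem le_of_forall_le_add_ofReal_mul {a b c : ℝ≥0∞} (hc : c ≠ ∞)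
    (h : ∀ ε : ℝ, 0 < ε → a ≤ b + ENNReal.ofReal (2 * ε) * c) : a ≤ b := by
  have h1 : Filter.Tendsto (fun ε : ℝ => b + ENNReal.ofReal (2 * ε) * c)
      (nhdsWithin 0 (Set.Ioi 0)) (nhds (b + ENNReal.ofReal (2 * 0) * c)) := by
    refine Filter.Tendsto.mono_left (Continuous.tendsto ?_ 0) nhdsWithin_le_nhds
    exact continuous_const.add ((ENNReal.continuous_mul_const hc).comp
      (ENNReal.continuous_ofReal.comp (continuous_const.mul continuous_id)))
  simp only [mul_zero, ENNReal.ofReal_zero, zero_mul, add_zero] at h1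
  exact ge_of_tendsto h1 (eventually_nhdsWithin_of_forall h)

theorem tsum_setLIntegral_add {ι : Type*} [Countable ι] {p : ι → Set (EuclideanSpace ℝ (Fin k))}
    (hd : Pairwise (Function.onFun Disjoint p)) (hm : ∀ i, MeasurableSet (p i))
    (g : EuclideanSpace ℝ (Fin k) → ℝ≥0∞) (a : ℝ≥0∞) :
    ∑' i, ((∫⁻ x in p i, g x) + a * volume (p i)) =
      (∫⁻ x in ⋃ i, p i, g x) + a * volume (⋃ i, p i) := by
  rw [ENNReal.tsum_add, lintegral_iUnion hm hd, measure_iUnion hd hm, ENNReal.tsum_mul_left]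

theorem hausdorffBorel_image_le_lintegral_of_finite (hk : 1 ≤ k) (hs : MeasurableSet s)
    (hfin : volume s ≠ ∞) (hf : ∀ x ∈ s, DifferentiableAt ℝ f x) :
    hausdorffBorel n k (f '' s) ≤ ∫⁻ x in s, ENNReal.ofReal (jacobian f x) := by
  refine le_of_forall_le_add_ofReal_mul hfin fun ε hε => ?_
  obtain ⟨p, hd, hm, rfl, hup, -⟩ := exists_partition_area_approx hk hs hf hε
  rw [Set.image_iUnion, ← tsum_setLIntegral_add hd hm]
  exact (measure_iUnion_le _).trans (ENNReal.tsum_le_tsum hup)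

theorem hausdorffBorel_image_le_lintegral (hk : 1 ≤ k) (hs : MeasurableSet s)
    (hf : ∀ x ∈ s, DifferentiableAt ℝ f x) :
    hausdorffBorel n k (f '' s) ≤ ∫⁻ x in s, ENNReal.ofReal (jacobian f x) := by
  set u := disjointed (spanningSets (volume : Measure (EuclideanSpace ℝ (Fin k))))
  have hu : ∀ i, MeasurableSet (u i) := fun i =>
    MeasurableSet.disjointed (fun j => measurableSet_spanningSets _ j) i
  have hus : ⋃ i, s ∩ u i = s := by
    rw [← Set.inter_iUnion, iUnion_disjointed, iUnion_spanningSets, Set.inter_univ]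
  have hd : Pairwise (Function.onFun Disjoint fun i => s ∩ u i) := fun i j hij =>
    ((disjoint_disjointed _) hij).mono Set.inter_subset_right Set.inter_subset_right
  conv_lhs => rw [← hus, Set.image_iUnion]
  conv_rhs => rw [← hus, lintegral_iUnion (fun i => hs.inter (hu i)) hd]
  refine (measure_iUnion_le _).trans (ENNReal.tsum_le_tsum fun i => ?_)
  refine hausdorffBorel_image_le_lintegral_of_finite hk (hs.inter (hu i)) ?_ fun x hx => hf x hx.1
  exact ((measure_mono (Set.inter_subset_right.trans (disjointed_subset _ i))).trans_lt
    (measure_spanningSets_lt_top _ i)).ne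

/-- Injectivity makes the images of the pieces disjoint, and injective continuous images of Borel
sets are Borel, so the measures of the images add up exactly and the local lower bounds can be
summed. -/
theorem lintegral_le_hausdorffBorel_image_of_finite (hk : 1 ≤ k) (hs : MeasurableSet s)
    (hfin : volume s ≠ ∞) (hf : ∀ x ∈ s, DifferentiableAt ℝ f x) (hc : Continuous f)
    (hJ : ∀ x ∈ s, jacobian f x ≠ 0) (hinj : Set.InjOn f s) :
    ∫⁻ x in s, ENNReal.ofReal (jacobian f x) ≤ hausdorffBorel n k (f '' s) := by
  refine le_of_forall_le_add_ofReal_mul hfin fun ε hε => ?_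
  obtain ⟨p, hd, hm, rfl, -, hlow⟩ := exists_partition_area_approx hk hs hf hε
  have hlow := fun i => hlow hJ i
  have hdisj : Pairwise (Function.onFun Disjoint fun i => f '' p i) := by
    intro i j hij
    rw [Function.onFun, Set.disjoint_left]
    rintro _ ⟨x, hx, rfl⟩ ⟨y, hy, hxy⟩
    have h := hinj (Set.mem_iUnion_of_mem j hy) (Set.mem_iUnion_of_mem i hx) hxy
    exact Set.disjoint_left.1 (hd hij) hx (h ▸ hy)
  rw [Set.image_iUnion, measure_iUnion hdisj
    fun i => (hm i).image_of_continuousOn_injOn hc.continuousOn (hlow i).1,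
    measure_iUnion hd hm, lintegral_iUnion hm hd, ← ENNReal.tsum_mul_left, ← ENNReal.tsum_add]
  exact ENNReal.tsum_le_tsum fun i => (hlow i).2

/-- The number of preimages of `y` in `s`. -/
noncomputable def preimageCount (f : EuclideanSpace ℝ (Fin k) → EuclideanSpace ℝ (Fin n))
    (s : Set (EuclideanSpace ℝ (Fin k))) (y : EuclideanSpace ℝ (Fin n)) : ℝ≥0∞ :=
  Measure.hausdorffMeasure 0 (s ∩ f ⁻¹' {y})

theorem preimageCount_eq_indicator (hinj : Set.InjOn f s) (y : EuclideanSpace ℝ (Fin n)) :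
    preimageCount f s y = (f '' s).indicator 1 y := by
  unfold preimageCount
  by_cases hy : y ∈ f '' s
  · obtain ⟨x, hx, rfl⟩ := hy
    have h : s ∩ f ⁻¹' {f x} = {x} := by
      ext z
      exact ⟨fun h => hinj h.1 hx h.2, fun h => by rw [Set.mem_singleton_iff.1 h]; exact ⟨hx, rfl⟩⟩
    rw [h, Set.indicator_of_mem (Set.mem_image_of_mem f hx)]
    simp
  · have h : s ∩ f ⁻¹' {y} = ∅ := by
      ext z
      exact ⟨fun h => hy ⟨z, h.1, h.2⟩, fun h => h.elim⟩
    rw [h, Set.indicator_of_notMem hy]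
    simp

theorem preimageCount_iUnion {ι : Type*} [Countable ι] {p : ι → Set (EuclideanSpace ℝ (Fin k))}
    (hd : Pairwise (Function.onFun Disjoint p)) (hm : ∀ i, MeasurableSet (p i))
    (hc : Continuous f) (y : EuclideanSpace ℝ (Fin n)) :
    preimageCount f (⋃ i, p i) y = ∑' i, preimageCount f (p i) y := by
  unfold preimageCount
  rw [Set.iUnion_inter, measure_iUnion]
  · exact fun i j hij => (hd hij).mono Set.inter_subset_left Set.inter_subset_left
  · exact fun i => (hm i).inter (hc.measurable (measurableSet_singleton y))

/-- The area formula on a Borel set of differentiability points with nonzero Jacobian. -/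
theorem measurable_and_lintegral_preimageCount (hk : 1 ≤ k) (hs : MeasurableSet s)
    (hf : ∀ x ∈ s, DifferentiableAt ℝ f x) (hc : Continuous f)
    (hJ : ∀ x ∈ s, jacobian f x ≠ 0) :
    MeasurableSet (f '' s) ∧ Measurable (preimageCount f s) ∧
      ∫⁻ y, preimageCount f s y ∂(hausdorffBorel n k) =
        ∫⁻ x in s, ENNReal.ofReal (jacobian f x) := by
  set u := disjointed (spanningSets (volume : Measure (EuclideanSpace ℝ (Fin k))))
  have hu : ∀ i, MeasurableSet (u i) := fun i =>
    MeasurableSet.disjointed (fun j => measurableSet_spanningSets _ j) i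
  have hU : ⋃ i, u i = Set.univ := by rw [iUnion_disjointed, iUnion_spanningSets]
  -- Only the injectivity on the pieces is used here, so any `ε` would do. Intersecting with `u`
  -- makes the volumes finite.
  obtain ⟨p, hd, hm, hps, -, hlow⟩ := exists_partition_area_approx hk hs hf one_pos
  set r : (ℕ × ℕ) × ℕ → Set (EuclideanSpace ℝ (Fin k)) := fun i => p i.1 ∩ u i.2
  have hrm : ∀ i, MeasurableSet (r i) := fun i => (hm i.1).inter (hu i.2)
  have hrs : ⋃ i, r i = s := by
    ext x
    simp only [r, Set.mem_iUnion, Prod.exists, ← hps]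
    constructor
    · rintro ⟨a, b, c, hx⟩
      exact ⟨a, b, hx.1⟩
    · rintro ⟨a, b, hx⟩
      obtain ⟨c, hc⟩ := Set.mem_iUnion.1 (hU ▸ Set.mem_univ x)
      exact ⟨a, b, c, hx, hc⟩
  have hrd : Pairwise (Function.onFun Disjoint r) := by
    rintro ⟨i, c⟩ ⟨i', c'⟩ hne
    by_cases hi : i = i'
    · have hcc : c ≠ c' := fun h => hne (by rw [hi, h])
      exact (disjoint_disjointed _ hcc).mono Set.inter_subset_right Set.inter_subset_right
    · exact (hd hi).mono Set.inter_subset_left Set.inter_subset_left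
  have hrsub : ∀ i, r i ⊆ s := fun i => hrs ▸ Set.subset_iUnion r i
  have hinj : ∀ i, Set.InjOn f (r i) := fun i => (hlow hJ i.1).1.mono Set.inter_subset_left
  have him : ∀ i, MeasurableSet (f '' r i) := fun i =>
    (hrm i).image_of_continuousOn_injOn hc.continuousOn (hinj i)
  have hmult : preimageCount f s = fun y => ∑' i, (f '' r i).indicator 1 y := by
    ext y
    rw [← hrs, preimageCount_iUnion hrd hrm hc]
    exact tsum_congr fun i => preimageCount_eq_indicator (hinj i) y
  refine ⟨?_, ?_, ?_⟩
  · rw [← hrs, Set.image_iUnion]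
    exact MeasurableSet.iUnion him
  · rw [hmult]
    exact Measurable.tsum fun i => measurable_one.indicator (him i)
  · rw [hmult, lintegral_tsum fun i => (measurable_one.indicator (him i)).aemeasurable]
    conv_rhs => rw [← hrs, lintegral_iUnion hrm hrd]
    refine tsum_congr fun i => ?_
    rw [lintegral_indicator_one (him i)]
    refine le_antisymm (hausdorffBorel_image_le_lintegral hk (hrm i) fun x hx => hf x (hrsub i hx))
      (lintegral_le_hausdorffBorel_image_of_finite hk (hrm i) ?_ (fun x hx => hf x (hrsub i hx)) hc
        (fun x hx => hJ x (hrsub i hx)) (hinj i))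
    exact ((measure_mono (Set.inter_subset_right.trans (disjointed_subset _ i.2))).trans_lt
      (measure_spanningSets_lt_top _ i.2)).ne

theorem hausdorffBorel_image_eq_zero_of_volume_eq_zero (hk : 1 ≤ k) {L : ℝ≥0}
    (hf : LipschitzWith L f) (hs : volume s = 0) : hausdorffBorel n k (f '' s) = 0 := by
  have h := hausdorffBorel_image_le (k := k) (f := f) (g := id) (s := s) L.2
    fun x _ y _ => by simpa [dist_eq_norm] using hf.dist_le_mul x y
  rwa [Set.image_id, hausdorffBorel_self hk, hs, mul_zero, nonpos_iff_eq_zero] at h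

theorem hausdorffBorel_image_eq_zero_of_jacobian_eq_zero (hk : 1 ≤ k) (hs : MeasurableSet s)
    (hf : ∀ x ∈ s, DifferentiableAt ℝ f x) (hJ : ∀ x ∈ s, jacobian f x = 0) :
    hausdorffBorel n k (f '' s) = 0 := by
  refine nonpos_iff_eq_zero.1 ((hausdorffBorel_image_le_lintegral hk hs hf).trans ?_)
  rw [setLIntegral_congr_fun hs (g := 0) fun x hx => by simp [hJ x hx]]
  simp

end Differentiable

/-! ### Carathéodory measurability and the passage from Borel measures. -/

theorem hausdorffOuter_apply (n k : ℕ) (s : Set (EuclideanSpace ℝ (Fin n))) :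
    hausdorffOuter n k s = hausdorffBorel n k s := by
  simp only [hausdorffOuter, hausdorffBorel, Real.rpow_natCast]
  rfl

theorem hausdorffOuter_eq (n k : ℕ) :
    hausdorffOuter n k = (hausdorffBorel n k).toOuterMeasure :=
  OuterMeasure.ext fun s => hausdorffOuter_apply n k s

theorem hausdorffOuter_zero_apply (k : ℕ) (s : Set (EuclideanSpace ℝ (Fin k))) :
    hausdorffOuter k 0 s = Measure.hausdorffMeasure 0 s := by
  have h : ENNReal.ofReal (omega 0 / 2 ^ (0 : ℝ)) = 1 := by simp [omega]
  rw [hausdorffOuter, h, one_smul]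
  rfl

theorem borel_le_caratheodory_hausdorffOuter (n k : ℕ) :
    (inferInstance : MeasurableSpace (EuclideanSpace ℝ (Fin n))) ≤
      (hausdorffOuter n k).caratheodory := by
  rw [hausdorffOuter_eq]
  exact le_toOuterMeasure_caratheodory _

theorem isCaratheodory_of_hausdorffOuter_eq_zero {n k : ℕ} {s : Set (EuclideanSpace ℝ (Fin n))}
    (h : hausdorffOuter n k s = 0) : (hausdorffOuter n k).IsCaratheodory s := by
  rw [OuterMeasure.isCaratheodory_iff_le']
  intro t
  have h1 : hausdorffOuter n k (t ∩ s) = 0 :=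
    measure_mono_null Set.inter_subset_right h
  rw [h1, zero_add]
  exact measure_mono Set.sdiff_subset

/-- Completeness lets measurability of the multiplicity function pass through an almost everywhere
equality. -/
theorem isComplete_hausdorff (n k : ℕ) : (hausdorff n k).IsComplete := by
  rw [Measure.isComplete_iff]
  intro s hs
  refine isCaratheodory_of_hausdorffOuter_eq_zero (nonpos_iff_eq_zero.1 ?_)
  rw [← hs]
  exact @le_toMeasure_apply _ (hausdorffOuter n k).caratheodory _ le_rfl s

theorem trim_hausdorff (n k : ℕ) :
    (hausdorff n k).trim (borel_le_caratheodory_hausdorffOuter n k) = hausdorffBorel n k := by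
  ext s hs
  rw [trim_measurableSet_eq _ hs, ← hausdorffOuter_apply]
  exact @toMeasure_apply _ (hausdorffOuter n k).caratheodory _ le_rfl s
    (borel_le_caratheodory_hausdorffOuter n k s hs)

end AreaFormula

/-! ### The area formula. -/

open AreaFormula in
theorem mainTheorem10 (k n : ℕ) (hk : 1 ≤ k) (hkn : k ≤ n)
    (Φ : EuclideanSpace ℝ (Fin k) → EuclideanSpace ℝ (Fin n))
    (hΦ : ∃ L : ℝ≥0, LipschitzWith L Φ)
    (E : Set (EuclideanSpace ℝ (Fin k)))
    (hE : NullMeasurableSet E (volume : Measure (EuclideanSpace ℝ (Fin k)))) :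
    (AreaFormula.hausdorffOuter n k).IsCaratheodory (Φ '' E) ∧
    (∀ᵐ x ∂(volume : Measure (EuclideanSpace ℝ (Fin k))), DifferentiableAt ℝ Φ x) ∧
    Measurable[(AreaFormula.hausdorffOuter n k).caratheodory]
      (fun y => AreaFormula.hausdorffOuter k 0 (E ∩ Φ ⁻¹' {y})) ∧
    ∫⁻ y, AreaFormula.hausdorffOuter k 0 (E ∩ Φ ⁻¹' {y}) ∂(AreaFormula.hausdorff n k) =
      ∫⁻ x in E, ENNReal.ofReal (AreaFormula.jacobian Φ x) := by
  obtain ⟨L, hL⟩ := hΦ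
  have hae : ∀ᵐ x ∂(volume : Measure (EuclideanSpace ℝ (Fin k))), DifferentiableAt ℝ Φ x :=
    hL.ae_differentiableAt
  obtain ⟨E₀, hE₀E, hE₀, hE₀ae⟩ := hE.exists_measurable_subset_ae_eq
  set D := {x | DifferentiableAt ℝ Φ x}
  have hD : MeasurableSet D := measurableSet_of_differentiableAt ℝ Φ
  set Z := {x | jacobian Φ x = 0}
  have hZ : MeasurableSet Z := measurable_jacobian (measurableSet_singleton 0)
  -- The Borel core of `E`, where the formula is already known. The rest of `E` is covered by a
  -- Lebesgue-null set and the critical set `D ∩ Z`, so its image is null.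
  set E₁ := (E₀ ∩ D) \ Z
  have hE₁ : MeasurableSet E₁ := (hE₀.inter hD).diff hZ
  have hE₁E : E₁ ⊆ E := fun x hx => hE₀E hx.1.1
  obtain ⟨him, hmm, hint⟩ := measurable_and_lintegral_preimageCount hk hE₁
    (fun x hx => hx.1.2) hL.continuous (fun x hx => hx.2)
  have hnull : hausdorffOuter n k (Φ '' (E \ E₁)) = 0 := by
    rw [hausdorffOuter_apply]
    have hN : volume ((E \ E₀) ∪ Dᶜ) = 0 :=
      measure_union_null (ae_le_set.1 hE₀ae.symm.le) hae
    refine measure_mono_null (t := Φ '' ((E \ E₀) ∪ Dᶜ) ∪ Φ '' (D ∩ Z)) ?_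
      (measure_union_null (hausdorffBorel_image_eq_zero_of_volume_eq_zero hk hL hN)
        (hausdorffBorel_image_eq_zero_of_jacobian_eq_zero hk (hD.inter hZ)
          (fun x hx => hx.1) fun x hx => hx.2))
    rw [← Set.image_union]
    refine Set.image_mono fun x hx => ?_
    by_cases h0 : x ∈ E₀
    · by_cases h1 : x ∈ D
      · by_cases h2 : x ∈ Z
        · exact .inr ⟨h1, h2⟩
        · exact absurd ⟨⟨h0, h1⟩, h2⟩ hx.2
      · exact .inl (.inr h1)
    · exact .inl (.inl ⟨hx.1, h0⟩)
  have hcar := isCaratheodory_of_hausdorffOuter_eq_zero hnull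
  have hle := borel_le_caratheodory_hausdorffOuter n k
  have hmm' : Measurable[(hausdorffOuter n k).caratheodory] (preimageCount Φ E₁) :=
    hmm.mono hle le_rfl
  -- The two multiplicities can differ only at points of the null set `Φ '' (E \ E₁)`.
  have haeq : preimageCount Φ E₁ =ᵐ[hausdorff n k]
      fun y => hausdorffOuter k 0 (E ∩ Φ ⁻¹' {y}) := by
    have h0 : hausdorff n k (Φ '' (E \ E₁)) = 0 := by
      rw [← hnull]
      exact @toMeasure_apply _ (hausdorffOuter n k).caratheodory _ le_rfl _ hcar
    filter_upwards [measure_eq_zero_iff_ae_notMem.1 h0] with y hy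
    rw [hausdorffOuter_zero_apply, preimageCount]
    congr 1
    ext x
    refine ⟨fun h => ⟨hE₁E h.1, h.2⟩, fun h => ⟨?_, h.2⟩⟩
    by_contra h1
    exact hy ⟨x, ⟨h.1, h1⟩, h.2⟩
  refine ⟨?_, hae, ?_, ?_⟩
  · have h := (hausdorffOuter n k).isCaratheodory_union (hle _ him) hcar
    rwa [← Set.image_union, Set.union_sdiff_cancel hE₁E] at h
  · have := isComplete_hausdorff n k
    exact @Measurable.congr_ae _ _ (hausdorffOuter n k).caratheodory _ (hausdorff n k) this _ _
      hmm' haeq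
  -- The multiplicity of `E₁` is Borel, so its integral can be computed with the Borel measure. On
  -- the right, discarding `E₀ \ (D \ Z)` is free: almost every point of it has zero Jacobian.
  · rw [← lintegral_congr_ae haeq, ← lintegral_trim hle hmm, trim_hausdorff, hint,
      ← setLIntegral_congr hE₀ae, ← lintegral_inter_add_sdiff _ E₀ (hD.diff hZ)]
    have h1 : ∫⁻ x in E₀ \ (D \ Z), ENNReal.ofReal (jacobian Φ x) = 0 := by
      rw [setLIntegral_eq_zero_iff (hE₀.diff (hD.diff hZ))
        (measurable_jacobian.ennreal_ofReal)]
      filter_upwards [hae] with x hx hx'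
      have hxZ : x ∈ Z := by
        by_contra h
        exact hx'.2 ⟨hx, h⟩
      rw [show jacobian Φ x = 0 from hxZ, ENNReal.ofReal_zero]
    rw [h1, add_zero, ← Set.inter_sdiff_assoc]
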